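/- **Conventions.** A hyperbolic space is a geodesic metric space $S$ for which there is $\delta\ge 0$ with $\langle x|y\rangle_o\ge\min\{\langle x|z\rangle_o,\langle z|y\rangle_o\}-\delta$ for all $x,y,z,o\in S$, where $\langle x|y\rangle_o=\frac12\big(d(x,o)+d(y,o)-d(x,y)\big)$. Its Gromov boundary $\partial S$ is the set of classes of sequences $(x_i)$ in $S$ with $\langle x_i|x_j\rangle_o\to\infty$ as $i,j\to\infty$, where $(x_i)\sim(y_i)$ if $\langle x_i|y_j\rangle_o\to\infty$. For $a,b\in\partial S$ and $s\in S$ put $\langle a|b\rangle_o=\inf\liminf_{i,j}\langle x_i|y_j\rangle_o$ and $\langle a|s\rangle_o=\inf\liminf_i\langle x_i|s\rangle_o$, the infima being over all sequences $(x_i)$ in the class $a$ and $(y_j)$ in the class $b$. The set $S\cup\partial S$ is given the topology in which $S$ is open and has its metric topology and in which the sets $\{s\in S\cup\partial S : \langle a|s\rangle_o>r\}$, $r\ge 0$, form a neighbourhood base at $a\in\partial S$. Let a group $G$ act on a hyperbolic space $S$ by isometries; then $G$ also acts on $\partial S$. The limit set $\Lambda_S(G)$ is the intersection of $\partial S$ with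 the closure in $S\cup\partial S$ of an orbit $Gs$ (it does not depend on $s\in S$). An element $g\in G$ is loxodromic if $\langle g\rangle$ has unbounded orbits in $S$ and fixes exactly two points of $\partial S$. The action is of general type if its orbits are unbounded and $G$ contains two loxodromic elements with disjoint sets of fixed points on $\partial S$. The group $G$ is *faithful weakly hyperbolic* if it admits a general type action on some hyperbolic space $S$ such that the induced action on $\Lambda_S(G)$ is faithful. It is *lim-free* if it admits a general type action on some hyperbolic space $S$ such that the induced action on $\Lambda_S(G)$ is topologically free, i.e. for every $g\in G\setminus\{1\}$ the set of fixed points of $g$ in $\Lambda_S(G)$ has empty interior in $\Lambda_S(G)$. The monolith $\mathrm{Mon}(G)$ is the intersection of all non-trivial normal subgroups of $G$, and $G$ is monolithic if $\mathrm{Mon}(G)\ne\{1\}$. **Proposition.** Let $G$ be a faithful weakly hyperbolic group. If $G$ is not lim-free, then $G$ is monolithic, and its monolith $\mathrm{Mon}(G)$ is infinite and simple. -/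

import Mathlib

open Filter Topology

universe u v

namespace WeakHyp

section GromovBoundary

variable {S : Type v} [MetricSpace S]

/-- The Gromov product `⟨x | y⟩_o`. -/
noncomputable def gromovProduct (o x y : S) : ℝ :=
  (dist x o + dist y o - dist x y) / 2

/-- A hyperbolic space: a geodesic metric space that satisfies Gromov's four point condition
for some `δ`. -/
class HyperbolicSpace (S : Type v) [MetricSpace S] : Prop where
  geodesic : ∀ x y : S, ∃ γ : ℝ → S, γ 0 = x ∧ γ (dist x y) = y ∧
    ∀ s ∈ Set.Icc 0 (dist x y), ∀ t ∈ Set.Icc 0 (dist x y), dist (γ s) (γ t) = |s - t|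
  four_point : ∃ δ : ℝ, 0 ≤ δ ∧ ∀ x y z o : S,
    min (gromovProduct o x z) (gromovProduct o z y) - δ ≤ gromovProduct o x y

/-- `⟨x_i | y_j⟩_o → ∞` as `i, j → ∞`, for every base point `o` (the condition does not depend
on `o`, since changing `o` to `o'` changes the products by at most `dist o o'`). -/
def ProductDiverges (x y : ℕ → S) : Prop :=
  ∀ o : S, Tendsto (fun p : ℕ × ℕ => gromovProduct o (x p.1) (y p.2)) atTop atTop

/-- The sequences of points of `S` that converge at infinity. -/
def SeqAtInfinity (S : Type v) [MetricSpace S] : Type v :=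
  {x : ℕ → S // ProductDiverges x x}

theorem gromovProduct_comm (o x y : S) : gromovProduct o x y = gromovProduct o y x := by
  unfold gromovProduct
  rw [dist_comm x y]
  ring

theorem ProductDiverges.symm {x y : ℕ → S} (h : ProductDiverges x y) : ProductDiverges y x := by
  intro o
  have hs : Tendsto (Prod.swap : ℕ × ℕ → ℕ × ℕ) atTop atTop := by
    rw [← prod_atTop_atTop_eq]
    exact tendsto_prod_swap
  exact ((h o).comp hs).congr fun p => gromovProduct_comm o _ _

theorem ProductDiverges.trans [HyperbolicSpace S] {x y z : ℕ → S}
    (hxy : ProductDiverges x y) (hyz : ProductDiverges y z) : ProductDiverges x z := by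
  obtain ⟨δ, -, hδ⟩ := HyperbolicSpace.four_point (S := S)
  intro o
  rw [tendsto_atTop_atTop]
  intro C
  obtain ⟨⟨a, b⟩, hab⟩ := tendsto_atTop_atTop.1 (hxy o) (C + δ)
  obtain ⟨⟨c, d⟩, hcd⟩ := tendsto_atTop_atTop.1 (hyz o) (C + δ)
  refine ⟨(a, d), fun p hp => ?_⟩
  have h1 := hab (p.1, max b c) ⟨hp.1, le_max_left _ _⟩
  have h2 := hcd (max b c, p.2) ⟨le_max_right _ _, hp.2⟩
  have h3 := hδ (x p.1) (z p.2) (y (max b c)) o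
  have h4 := le_min h1 h2
  simp only at h4
  linarith

instance seqSetoid (S : Type v) [MetricSpace S] [HyperbolicSpace S] :
    Setoid (SeqAtInfinity S) where
  r x y := ProductDiverges x.1 y.1
  iseqv := ⟨fun x => x.2, fun h => h.symm, fun h k => h.trans k⟩

/-- The Gromov boundary `∂S`. -/
def Boundary (S : Type v) [MetricSpace S] [HyperbolicSpace S] : Type v :=
  Quotient (seqSetoid S)

/-- The sequence `x` converges to the boundary point `a`. -/
def ConvergesTo [HyperbolicSpace S] (x : ℕ → S) (a : Boundary S) : Prop :=
  ∃ hx : ProductDiverges x x, (Quotient.mk (seqSetoid S) ⟨x, hx⟩ : Boundary S) = a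

/-- The set `S ∪ ∂S`. -/
inductive Bordification (S : Type v) [MetricSpace S] [HyperbolicSpace S] : Type v
  | inner (x : S) : Bordification S
  | ideal (a : Boundary S) : Bordification S

/-- The Gromov product `⟨a | s⟩_o` of a boundary point `a` with a point `s` of `S ∪ ∂S`;
its value may be `∞`. -/
noncomputable def boundaryProduct [HyperbolicSpace S] (o : S) (a : Boundary S) :
    Bordification S → EReal
  | .inner s => ⨅ (x : ℕ → S) (_ : ConvergesTo x a),
      liminf (fun i : ℕ => ((gromovProduct o (x i) s : ℝ) : EReal)) atTop
  | .ideal b => ⨅ (x : ℕ → S) (_ : ConvergesTo x a) (y : ℕ → S) (_ : ConvergesTo y b),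
      liminf (fun p : ℕ × ℕ => ((gromovProduct o (x p.1) (y p.2) : ℝ) : EReal)) atTop

/-- `U_o(a, r)`, the set of points `s` of `S ∪ ∂S` with `⟨a | s⟩_o > r`. -/
def basicNhd [HyperbolicSpace S] (o : S) (a : Boundary S) (r : ℝ) : Set (Bordification S) :=
  {s | (r : EReal) < boundaryProduct o a s}

/-- The topology of `S ∪ ∂S`: the space `S` is open and has its own topology, and the sets
`U_o(a, r)` are a base of neighbourhoods of the boundary point `a`. -/
instance bordificationTopology [HyperbolicSpace S] : TopologicalSpace (Bordification S) where
  IsOpen V := IsOpen {x : S | Bordification.inner x ∈ V} ∧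
    ∀ a : Boundary S, Bordification.ideal a ∈ V → ∀ o : S, ∃ r : ℝ, basicNhd o a r ⊆ V
  isOpen_univ := ⟨by simp, fun _ _ _ => ⟨0, Set.subset_univ _⟩⟩
  isOpen_inter V W hV hW := by
    refine ⟨hV.1.inter hW.1, fun a ha o => ?_⟩
    obtain ⟨r, hr⟩ := hV.2 a ha.1 o
    obtain ⟨t, ht⟩ := hW.2 a ha.2 o
    refine ⟨max r t, fun s hs => ⟨hr ?_, ht ?_⟩⟩
    · exact lt_of_le_of_lt (EReal.coe_le_coe_iff.2 (le_max_left r t)) hs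
    · exact lt_of_le_of_lt (EReal.coe_le_coe_iff.2 (le_max_right r t)) hs
  isOpen_sUnion C hC := by
    refine ⟨?_, fun a ha o => ?_⟩
    · have : {x : S | Bordification.inner x ∈ ⋃₀ C} =
          ⋃ V ∈ C, {x : S | Bordification.inner x ∈ V} := by
        ext x
        simp
      rw [this]
      exact isOpen_biUnion fun V hV => (hC V hV).1
    · obtain ⟨V, hV, haV⟩ := ha
      obtain ⟨r, hr⟩ := (hC V hV).2 a haV o
      exact ⟨r, hr.trans (Set.subset_sUnion_of_mem hV)⟩

/-- `∂S` carries the topology induced from `S ∪ ∂S`. -/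
instance boundaryTopology [HyperbolicSpace S] : TopologicalSpace (Boundary S) :=
  TopologicalSpace.induced Bordification.ideal bordificationTopology

end GromovBoundary

section Actions

variable {G : Type u} [Group G] {S : Type v} [MetricSpace S] [MulAction G S] [IsIsometricSMul G S]

theorem gromovProduct_smul (g : G) (o x y : S) :
    gromovProduct o (g • x) (g • y) = gromovProduct (g⁻¹ • o) x y := by
  unfold gromovProduct
  have h (z : S) : dist (g • z) o = dist z (g⁻¹ • o) := by
    rw [← dist_smul g z (g⁻¹ • o), smul_inv_smul]
  rw [h, h, dist_smul]

theorem ProductDiverges.smul (g : G) {x y : ℕ → S} (h : ProductDiverges x y) :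
    ProductDiverges (fun i => g • x i) (fun i => g • y i) := fun o =>
  (h (g⁻¹ • o)).congr fun p => (gromovProduct_smul g o (x p.1) (y p.2)).symm

/-- The action of `G` on `∂S` that is induced by an isometric action on `S`:
the class of `(x_i)` is sent by `g` to the class of `(g x_i)`. -/
instance boundaryAction [HyperbolicSpace S] : MulAction G (Boundary S) where
  smul g := Quotient.map' (s₁ := seqSetoid S) (s₂ := seqSetoid S)
    (fun x => ⟨fun i => g • x.1 i, x.2.smul g⟩) (fun _ _ h => ProductDiverges.smul g h)
  one_smul a := by
    refine Quotient.inductionOn a fun x => ?_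
    refine congrArg (Quotient.mk (seqSetoid S)) (a₁ := ⟨fun i => (1 : G) • x.1 i, x.2.smul 1⟩) ?_
    exact Subtype.ext (funext fun i => one_smul G (x.1 i))
  mul_smul g h a := by
    refine Quotient.inductionOn a fun x => ?_
    refine congrArg (Quotient.mk (seqSetoid S))
      (a₁ := ⟨fun i => (g * h) • x.1 i, x.2.smul (g * h)⟩)
      (a₂ := ⟨fun i => g • h • x.1 i, (x.2.smul h).smul g⟩) ?_
    exact Subtype.ext (funext fun i => mul_smul g h (x.1 i))

variable (G) (S)

/-- The limit set `Λ_S(G)`: the boundary points in the closure (in `S ∪ ∂S`) of an orbit `G s`.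
The closures of any two orbits have the same boundary points, so `s` does not matter. -/
def limitSet [HyperbolicSpace S] : Set (Boundary S) :=
  {a | ∃ s : S, Bordification.ideal a ∈ closure (Bordification.inner '' MulAction.orbit G s)}

variable {G}

/-- `g` is loxodromic: the group generated by `g` has unbounded orbits in `S` and fixes exactly
two points of `∂S`. -/
def IsLoxodromic [HyperbolicSpace S] (g : G) : Prop :=
  (∀ s : S, ¬ Bornology.IsBounded (Set.range fun n : ℤ => g ^ n • s)) ∧
    (MulAction.fixedBy (Boundary S) g).encard = 2

variable (G)

/-- The action of `G` on `S` is of general type. -/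
def IsGeneralType [HyperbolicSpace S] : Prop :=
  (∀ s : S, ¬ Bornology.IsBounded (MulAction.orbit G s)) ∧
    ∃ g h : G, IsLoxodromic S g ∧ IsLoxodromic S h ∧
      Disjoint (MulAction.fixedBy (Boundary S) g) (MulAction.fixedBy (Boundary S) h)

/-- The induced action of `G` on `Λ_S(G)` is faithful. -/
def FaithfulOnLimitSet [HyperbolicSpace S] : Prop :=
  ∀ g : G, (∀ a ∈ limitSet G S, g • a = a) → g = 1

/-- The induced action of `G` on `Λ_S(G)` is topologically free: the fixed point set in `Λ_S(G)`
of every nontrivial element has empty interior in `Λ_S(G)`. -/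
def TopologicallyFreeOnLimitSet [HyperbolicSpace S] : Prop :=
  ∀ g : G, g ≠ 1 → interior {a : limitSet G S | g • (a : Boundary S) = a} = ∅

/-- `G` is faithful weakly hyperbolic: some general type action of `G` on a hyperbolic space
induces a faithful action on the limit set. -/
def IsFaithfulWeaklyHyperbolic : Prop :=
  ∃ (S : Type v) (_ : MetricSpace S) (_ : HyperbolicSpace S) (_ : MulAction G S)
    (_ : IsIsometricSMul G S), IsGeneralType G S ∧ FaithfulOnLimitSet G S

/-- `G` is lim-free: some general type action of `G` on a hyperbolic space induces a
topologically free action on the limit set. -/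
def IsLimFree : Prop :=
  ∃ (S : Type v) (_ : MetricSpace S) (_ : HyperbolicSpace S) (_ : MulAction G S)
    (_ : IsIsometricSMul G S), IsGeneralType G S ∧ TopologicallyFreeOnLimitSet G S

/-- The monolith of `G`: the intersection of all nontrivial normal subgroups of `G`. -/
def monolith : Subgroup G :=
  sInf {N : Subgroup G | N.Normal ∧ N ≠ ⊥}

/-- `G` is monolithic: its monolith is nontrivial. -/
def IsMonolithic : Prop :=
  monolith G ≠ ⊥

end Actions

end WeakHyp

/-! The argument plays out on the limit set of an action witnessing that `G` is faithful weakly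
hyperbolic. As `G` is not lim-free, topological freeness fails for this action: some `g ≠ 1` fixes a
nonempty open subset of the limit set pointwise.

Geometry enters through two facts. North-south dynamics of a loxodromic element, together with a
second one sharing no fixed point with it, makes the action extremely proximal
(`IsGeneralType.compresses`), and the limit set is infinite (`IsGeneralType.infinite_limitSet`).

The rest is topological dynamics (`monolith_of_compresses`). Conjugates of `g` have arbitrarily
small support. If a nontrivial element of a normal subgroup `N` displaces an open set `V`, a double
commutator trick puts `⁅a, b⁆` in `N` for all `a`, `b` supported in `V`. Since proper closed sets
can be moved into `V`, every nontrivial `N` contains the same nontrivial commutators, so the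
monolith is nontrivial. The monolith inherits both extreme proximality and small supports, so the
trick applies again to its own normal subgroups and gives simplicity. -/

namespace WeakHyp

/-! ### Extremely proximal actions and the simplicity of the monolith. -/

section Compression

open scoped commutatorElement

variable {G : Type u} [Group G] {X : Type v} [MulAction G X]

theorem exists_smul_ne [FaithfulSMul G X] {g : G} (hg : g ≠ 1) : ∃ x : X, g • x ≠ x := by
  by_contra! h
  exact hg (FaithfulSMul.eq_of_smul_eq_smul (α := X) fun x => by rw [h x, one_smul])

theorem smul_mem_of_support {a : G} {A : Set X} (ha : ∀ x ∉ A, a • x = x) {x : X} (hx : x ∈ A) :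
    a • x ∈ A := by
  by_contra h
  have h1 : a • x = x := smul_left_cancel a (ha _ h)
  exact h (h1.symm ▸ hx)

theorem conj_support {a g : G} {A B : Set X} (ha : ∀ x ∉ A, a • x = x)
    (hg : ∀ x ∈ A, g • x ∈ B) : ∀ x ∉ B, (g * a * g⁻¹) • x = x := by
  intro x hx
  have h : g⁻¹ • x ∉ A := fun h => hx (by simpa using hg _ h)
  rw [mul_smul, mul_smul, ha _ h, smul_inv_smul]

theorem commute_of_support [FaithfulSMul G X] {a b : G} {A B : Set X} (hAB : Disjoint A B)
    (ha : ∀ x ∉ A, a • x = x) (hb : ∀ x ∉ B, b • x = x) : a * b = b * a := by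
  refine FaithfulSMul.eq_of_smul_eq_smul (α := X) fun x => ?_
  rw [mul_smul, mul_smul]
  by_cases hA : x ∈ A
  · rw [hb x (Set.disjoint_left.1 hAB hA),
      hb _ (Set.disjoint_left.1 hAB (smul_mem_of_support ha hA))]
  · rw [ha x hA]
    by_cases hB : x ∈ B
    · exact ha _ (Set.disjoint_right.1 hAB (smul_mem_of_support hb hB))
    · rw [hb x hB, ha x hA]

/-- A subgroup containing an element `n` that displaces `V` contains the commutators of those
elements supported in `V` that normalise it. -/
theorem commutator_mem_of_displaces [FaithfulSMul G X] {K : Subgroup G} {n a b : G} {V : Set X}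
    (hn : n ∈ K) (hV : ∀ x ∈ V, n • x ∉ V) (ha : ∀ x ∉ V, a • x = x) (hb : ∀ x ∉ V, b • x = x)
    (haK : ∀ k ∈ K, a * k * a⁻¹ ∈ K) (hbK : ∀ k ∈ K, b * k * b⁻¹ ∈ K) : ⁅a, b⁆ ∈ K := by
  -- `n * a * n⁻¹` is supported off `V`, so it commutes with `b`; hence `⁅⁅a, n⁆, b⁆` collapses to
  -- `⁅a, b⁆`, while `⁅a, n⁆` already lies in `K`.
  have hc : (n * a * n⁻¹) * b = b * (n * a * n⁻¹) :=
    commute_of_support (A := Vᶜ) (B := V) disjoint_compl_left (conj_support ha hV) hb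
  have h1 : a * n * a⁻¹ * n⁻¹ ∈ K := K.mul_mem (haK n hn) (K.inv_mem hn)
  have h2 : (a * n * a⁻¹ * n⁻¹) * (b * (a * n * a⁻¹ * n⁻¹)⁻¹ * b⁻¹) ∈ K :=
    K.mul_mem h1 (hbK _ (K.inv_mem h1))
  have h3 : (a * n * a⁻¹ * n⁻¹) * (b * (a * n * a⁻¹ * n⁻¹)⁻¹ * b⁻¹) = ⁅a, b⁆ := by
    rw [commutatorElement_def]
    calc (a * n * a⁻¹ * n⁻¹) * (b * (a * n * a⁻¹ * n⁻¹)⁻¹ * b⁻¹)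
        = a * (n * a * n⁻¹)⁻¹ * (b * (n * a * n⁻¹)) * a⁻¹ * b⁻¹ := by group
      _ = a * b * a⁻¹ * b⁻¹ := by rw [← hc]; group
  exact h3 ▸ h2

variable [TopologicalSpace X]

/-- Elements of `M` can map every proper closed subset of `X` into every nonempty open subset:
the action of `M` is extremely proximal. -/
def Compresses (X : Type v) [TopologicalSpace X] [MulAction G X] (M : Subgroup G) : Prop :=
  ∀ C : Set X, IsClosed C → C ≠ Set.univ → ∀ U : Set X, IsOpen U → U.Nonempty →
    ∃ m ∈ M, ∀ x ∈ C, m • x ∈ U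

/-- Every nonempty open subset of `X` supports a nontrivial element of `M`. -/
def MicroSupported (X : Type v) [TopologicalSpace X] [MulAction G X] (M : Subgroup G) : Prop :=
  ∀ U : Set X, IsOpen U → U.Nonempty → ∃ m ∈ M, m ≠ 1 ∧ ∀ x ∉ U, m • x = x

theorem exists_displaced [T2Space X] [ContinuousConstSMul G X] {n : G} {x : X}
    (hx : n • x ≠ x) : ∃ V : Set X, IsOpen V ∧ x ∈ V ∧ ∀ y ∈ V, n • y ∉ V := by
  obtain ⟨A, B, hA, hB, hxA, hxB, hAB⟩ := t2_separation hx
  refine ⟨B ∩ (fun y => n • y) ⁻¹' A, hB.inter (hA.preimage (continuous_const_smul n)),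
    ⟨hxB, hxA⟩, fun y hy hy' => Set.disjoint_left.1 hAB hy.2 hy'.1⟩

/-- Some `m ∈ M` carries `C` into a set displaced by an element of `K`; the commutator trick is
applied there and the result is conjugated back. Keeping `M` and `K` separate allows two uses: `M =
⊤` with `K` normal in `G`, and `M` the monolith with `K` normal only in it. -/
theorem commutator_mem_of_compresses [T2Space X] [ContinuousConstSMul G X] [FaithfulSMul G X]
    {M K : Subgroup G} (hM : Compresses X M) (hK : K ≠ ⊥)
    (hMK : ∀ m ∈ M, ∀ k ∈ K, m * k * m⁻¹ ∈ K) {C : Set X} (hC : IsClosed C) (hC' : C ≠ Set.univ)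
    {a b : G} (ha : a ∈ M) (hb : b ∈ M) (haC : ∀ x ∉ C, a • x = x) (hbC : ∀ x ∉ C, b • x = x) :
    ⁅a, b⁆ ∈ K := by
  obtain ⟨n, hn, hn1⟩ := K.bot_or_exists_ne_one.resolve_left hK
  obtain ⟨x, hx⟩ := exists_smul_ne (X := X) hn1
  obtain ⟨V, hV, hxV, hnV⟩ := exists_displaced hx
  obtain ⟨m, hm, hmC⟩ := hM C hC hC' V hV ⟨x, hxV⟩
  have hconj {c : G} (hc : c ∈ M) : m * c * m⁻¹ ∈ M := M.mul_mem (M.mul_mem hm hc) (M.inv_mem hm)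
  have h := commutator_mem_of_displaces hn hnV (conj_support haC hmC) (conj_support hbC hmC)
    (hMK _ (hconj ha)) (hMK _ (hconj hb))
  have h' := hMK _ (M.inv_mem hm) _ h
  have he : m⁻¹ * ⁅m * a * m⁻¹, m * b * m⁻¹⁆ * m⁻¹⁻¹ = ⁅a, b⁆ := by
    simp only [commutatorElement_def]
    group
  rwa [he] at h'

/-- Extreme proximality passes to nontrivial normal subgroups. -/
theorem Compresses.of_normal [T2Space X] [ContinuousConstSMul G X] [FaithfulSMul G X]
    (hG : Compresses X (⊤ : Subgroup G)) {M : Subgroup G} (hM : M.Normal) (hM1 : M ≠ ⊥) :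
    Compresses X M := by
  obtain ⟨n, hn, hn1⟩ := M.bot_or_exists_ne_one.resolve_left hM1
  obtain ⟨x, hx⟩ := exists_smul_ne (X := X) hn1
  obtain ⟨V, hV, hxV, hnV⟩ := exists_displaced hx
  -- Conjugating `n` by an element that sends `C` into the displaced set `V` gives an element of `M`
  -- moving `C` off itself.
  have key (C : Set X) (hC : IsClosed C) (hC' : C ≠ Set.univ) : ∃ m ∈ M, ∀ y ∈ C, m • y ∉ C := by
    obtain ⟨g, -, hg⟩ := hG C hC hC' V hV ⟨x, hxV⟩
    refine ⟨g⁻¹ * n * g, by simpa using hM.conj_mem n hn g⁻¹, fun y hy hy' => hnV _ (hg y hy) ?_⟩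
    simpa [mul_smul] using hg _ hy'
  -- When `U` is not inside `C`, the set `C ∪ Uᶜ` is still proper, and moving it off itself sends
  -- `C` into `U`.
  have key' (C : Set X) (hC : IsClosed C) (U : Set X) (hU : IsOpen U) (hUC : ¬ U ⊆ C) :
      ∃ m ∈ M, ∀ y ∈ C, m • y ∈ U := by
    obtain ⟨z, hzU, hzC⟩ := Set.not_subset.1 hUC
    obtain ⟨m, hm, h⟩ := key (C ∪ Uᶜ) (hC.union hU.isClosed_compl)
      (fun h => (h ▸ Set.mem_univ z : z ∈ C ∪ Uᶜ).elim hzC fun h => h hzU)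
    exact ⟨m, hm, fun y hy => by simpa using fun hy' => h y (Or.inl hy) (Or.inr hy')⟩
  intro C hC hC' U hU hUne
  by_cases hUC : U ⊆ C
  -- If `U ⊆ C`, first move `C` off itself: the translate `m • C`, written as a preimage under
  -- `m⁻¹`, no longer contains `U`.
  · obtain ⟨m, hm, h⟩ := key C hC hC'
    obtain ⟨m', hm', h'⟩ := key' ((fun y => m⁻¹ • y) ⁻¹' C)
      (hC.preimage (continuous_const_smul m⁻¹)) U hU (fun hsub => by
        obtain ⟨z, hz⟩ := hUne
        exact h _ (hsub hz) (by simpa using hUC hz))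
    exact ⟨m' * m, M.mul_mem hm' hm, fun y hy => by
      rw [mul_smul]
      exact h' _ (by simpa using hy)⟩
  · exact key' C hC U hU hUC

/-- Take `a` supported in `U`, a set `V` displaced by `a`, and `b` supported in `U ∩ V`. If they
commuted, then at a point `y` moved by `b` the point `a • y`, being outside `V`, would be fixed by
`b`, forcing `b • y = y`. -/
theorem MicroSupported.exists_commutator_ne_one [T2Space X] [ContinuousConstSMul G X]
    [FaithfulSMul G X] {M : Subgroup G} (hM : MicroSupported X M) {U : Set X} (hU : IsOpen U)
    (hUne : U.Nonempty) : ∃ a ∈ M, ∃ b ∈ M, (∀ x ∉ U, a • x = x) ∧ (∀ x ∉ U, b • x = x) ∧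
      ⁅a, b⁆ ≠ 1 := by
  obtain ⟨a, ha, ha1, haU⟩ := hM U hU hUne
  obtain ⟨x, hx⟩ := exists_smul_ne (X := X) ha1
  have hxU : x ∈ U := by
    by_contra h
    exact hx (haU x h)
  obtain ⟨V, hV, hxV, haV⟩ := exists_displaced hx
  obtain ⟨b, hb, hb1, hbV⟩ := hM (U ∩ V) (hU.inter hV) ⟨x, hxU, hxV⟩
  refine ⟨a, ha, b, hb, haU, fun y hy => hbV y fun h => hy h.1, fun hab => ?_⟩
  obtain ⟨y, hy⟩ := exists_smul_ne (X := X) hb1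
  have hyV : y ∈ V := by
    by_contra h
    exact hy (hbV y fun h' => h h'.2)
  have hab' := congrArg (fun g : G => g • y) (commutatorElement_eq_one_iff_mul_comm.1 hab)
  simp only [mul_smul] at hab'
  rw [hbV (a • y) fun h => haV y hyV h.2] at hab'
  exact hy (smul_left_cancel a hab')

/-- The support of `g` lies in the complement of the interior of its fixed set, a proper closed set;
conjugating by an element that compresses this set into `U` moves the support into `U`. -/
theorem MicroSupported.of_compresses [FaithfulSMul G X] [ContinuousConstSMul G X]
    (hG : Compresses X (⊤ : Subgroup G)) {g : G} (hg : g ≠ 1)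
    (hfix : (interior {x : X | g • x = x}).Nonempty) : MicroSupported X (⊤ : Subgroup G) := by
  intro U hU hUne
  obtain ⟨k, -, hk⟩ := hG (interior {x : X | g • x = x})ᶜ isOpen_interior.isClosed_compl
    (fun h => by simp [Set.compl_univ_iff] at h; simp [h] at hfix) U hU hUne
  refine ⟨k * g * k⁻¹, trivial, fun h => hg (by simpa using h), conj_support (fun x hx => ?_) hk⟩
  have h : x ∈ {x : X | g • x = x} := interior_subset (not_not.1 hx)
  exact h

/-- Every nonempty open set contains a nonempty open subset of a proper closed set. -/
theorem exists_open_subset_proper_closed [T2Space X] [Nontrivial X] {U : Set X} (hU : IsOpen U)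
    (hUne : U.Nonempty) : ∃ V C : Set X, IsOpen V ∧ V.Nonempty ∧ V ⊆ U ∧ V ⊆ C ∧ IsClosed C ∧
      C ≠ Set.univ := by
  obtain ⟨x, hx⟩ := hUne
  obtain ⟨y, hy⟩ := exists_ne x
  obtain ⟨A, B, hA, hB, hyA, hxB, hAB⟩ := t2_separation hy
  refine ⟨U ∩ B, Aᶜ, hU.inter hB, ⟨x, hx, hxB⟩, Set.inter_subset_left,
    fun z hz hzA => Set.disjoint_left.1 hAB hzA hz.2, hA.isClosed_compl, fun h => ?_⟩
  exact (h ▸ Set.mem_univ y : y ∈ Aᶜ) hyA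

instance monolith_normal : (monolith G).Normal := by
  refine ⟨fun n hn g => ?_⟩
  simp only [monolith, Subgroup.mem_sInf, Set.mem_ofPred_eq] at hn ⊢
  exact fun N hN => hN.1.conj_mem n (hn N hN) g

/-- A group with a faithful extremely proximal action on an infinite Hausdorff space that is not
topologically free is monolithic, with infinite simple monolith. -/
theorem monolith_of_compresses [T2Space X] [Infinite X] [ContinuousConstSMul G X]
    [FaithfulSMul G X] (hG : Compresses X (⊤ : Subgroup G)) {g : G} (hg : g ≠ 1)
    (hfix : (interior {x : X | g • x = x}).Nonempty) :
    IsMonolithic G ∧ Infinite (monolith G) ∧ IsSimpleGroup (monolith G) := by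
  have hmicro := MicroSupported.of_compresses hG hg hfix
  have hmicro' : MicroSupported X (monolith G) := by
    intro U hU hUne
    obtain ⟨V, C, hV, hVne, hVU, hVC, hC, hC'⟩ := exists_open_subset_proper_closed hU hUne
    obtain ⟨a, -, b, -, haV, hbV, hab⟩ := hmicro.exists_commutator_ne_one hV hVne
    refine ⟨⁅a, b⁆, ?_, hab, fun x hx => ?_⟩
    · refine Subgroup.mem_sInf.2 fun N hN => ?_
      exact commutator_mem_of_compresses hG hN.2 (fun m _ k hk => hN.1.conj_mem k hk m) hC hC'
        (Subgroup.mem_top a) (Subgroup.mem_top b) (fun x hx => haV x fun h => hx (hVC h))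
        (fun x hx => hbV x fun h => hx (hVC h))
    · have ha := haV x fun h => hx (hVU h)
      have hb := hbV x fun h => hx (hVU h)
      rw [commutatorElement_def, mul_smul, mul_smul, mul_smul, inv_smul_eq_iff.2 hb.symm,
        inv_smul_eq_iff.2 ha.symm, hb, ha]
  have hne : monolith G ≠ ⊥ := by
    obtain ⟨m, hm, hm1, -⟩ := hmicro' Set.univ isOpen_univ Set.univ_nonempty
    exact fun h => hm1 (by rwa [h, Subgroup.mem_bot] at hm)
  have hcomp : Compresses X (monolith G) := hG.of_normal monolith_normal hne
  refine ⟨hne, ?_, ?_⟩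
  -- A finite orbit of `x` would be closed, yet `{x}` can be compressed into its complement.
  · by_contra hfin
    rw [not_infinite_iff_finite] at hfin
    obtain ⟨x⟩ : Nonempty X := inferInstance
    have hS : (Set.range fun m : monolith G => (m : G) • x).Finite := Set.finite_range _
    obtain ⟨y, hy⟩ := hS.infinite_compl.nonempty
    obtain ⟨z, hz⟩ := exists_ne x
    obtain ⟨m, hm, h⟩ := hcomp {x} isClosed_singleton
      (fun h => hz (h ▸ Set.mem_univ z : z ∈ ({x} : Set X))) _ hS.isClosed.isOpen_compl ⟨y, hy⟩
    exact h x rfl ⟨⟨m, hm⟩, rfl⟩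
  · have : Nontrivial (monolith G) := (Subgroup.nontrivial_iff_ne_bot _).2 hne
    refine ⟨fun K hK => or_iff_not_imp_left.2 fun hK1 => ?_⟩
    -- `K` is normal only in the monolith, but `T` is invariant under all of `G`. Its normal closure
    -- in `G` is thus the subgroup generated by `T`: it lies inside `K`, and contains the monolith
    -- because it is nontrivial.
    set T : Set G := {t | ∃ C : Set X, IsClosed C ∧ C ≠ Set.univ ∧ ∃ a ∈ monolith G,
      ∃ b ∈ monolith G, (∀ x ∉ C, a • x = x) ∧ (∀ x ∉ C, b • x = x) ∧ t = ⁅a, b⁆} with hT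
    have hTK : T ⊆ K.map (monolith G).subtype := by
      rintro t ⟨C, hC, hC', a, ha, b, hb, haC, hbC, rfl⟩
      refine commutator_mem_of_compresses hcomp
        (fun h => hK1 ((Subgroup.map_eq_bot_iff_of_injective _ Subtype.val_injective).1 h))
        ?_ hC hC' ha hb haC hbC
      rintro m hm _ ⟨k, hk, rfl⟩
      exact ⟨_, hK.conj_mem k hk ⟨m, hm⟩, rfl⟩
    have hTconj : Group.conjugatesOfSet T ⊆ T := by
      intro t ht
      obtain ⟨_, ⟨C, hC, hC', a, ha, b, hb, haC, hbC, rfl⟩, h⟩ :=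
        Group.mem_conjugatesOfSet_iff.1 ht
      obtain ⟨k, rfl⟩ := isConj_iff.1 h
      have hkC : ∀ x ∈ C, k • x ∈ (fun y => k⁻¹ • y) ⁻¹' C := fun x hx => by simpa using hx
      refine ⟨(fun y => k⁻¹ • y) ⁻¹' C, hC.preimage (continuous_const_smul k⁻¹), fun h => hC' ?_,
        k * a * k⁻¹, monolith_normal.conj_mem a ha k, k * b * k⁻¹,
        monolith_normal.conj_mem b hb k, conj_support haC hkC, conj_support hbC hkC, ?_⟩
      · refine Set.eq_univ_of_forall fun x => ?_
        have : k • x ∈ (fun y => k⁻¹ • y) ⁻¹' C := h ▸ Set.mem_univ _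
        simpa using this
      · simp only [commutatorElement_def]
        group
    have hTne : Subgroup.normalClosure T ≠ ⊥ := by
      obtain ⟨V, C, hV, hVne, -, hVC, hC, hC'⟩ :=
        exists_open_subset_proper_closed (X := X) isOpen_univ Set.univ_nonempty
      obtain ⟨a, ha, b, hb, haV, hbV, hab⟩ := hmicro'.exists_commutator_ne_one hV hVne
      intro h
      have hmem : ⁅a, b⁆ ∈ Subgroup.normalClosure T := Subgroup.subset_normalClosure
        ⟨C, hC, hC', a, ha, b, hb, fun x hx => haV x fun h => hx (hVC h),
          fun x hx => hbV x fun h => hx (hVC h), rfl⟩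
      exact hab (by rwa [h, Subgroup.mem_bot] at hmem)
    have hle : monolith G ≤ K.map (monolith G).subtype :=
      (sInf_le ⟨Subgroup.normalClosure_normal, hTne⟩ : monolith G ≤ Subgroup.normalClosure T).trans
        ((Subgroup.closure_le _).2 (hTconj.trans hTK))
    refine (Subgroup.eq_top_iff' K).2 fun k => ?_
    obtain ⟨k', hk', h⟩ := hle k.2
    rwa [← Subtype.ext h]

end Compression

end WeakHyp

namespace WeakHyp

/-! ### Gromov products on `S ∪ ∂S` and the topology they define. -/

section Products

variable {S : Type v} [MetricSpace S]

theorem gromovProduct_base_change (o o' x y : S) :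
    gromovProduct o x y - dist o o' ≤ gromovProduct o' x y := by
  unfold gromovProduct
  linarith [dist_triangle x o' o, dist_triangle y o' o, dist_comm o o']

theorem gromovProduct_point_change (o x y y' : S) :
    gromovProduct o x y - dist y y' ≤ gromovProduct o x y' := by
  unfold gromovProduct
  linarith [dist_triangle y y' o, dist_triangle x y y']

variable [HyperbolicSpace S]

/-- A hyperbolicity constant of `S`. -/
noncomputable def hypConst (S : Type v) [MetricSpace S] [HyperbolicSpace S] : ℝ :=
  (HyperbolicSpace.four_point (S := S)).choose

theorem hypConst_nonneg (S : Type v) [MetricSpace S] [HyperbolicSpace S] : 0 ≤ hypConst S :=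
  (HyperbolicSpace.four_point (S := S)).choose_spec.1

theorem le_gromovProduct {o x y z : S} {r : ℝ} (h : r ≤ gromovProduct o x z)
    (h' : r ≤ gromovProduct o z y) : r - hypConst S ≤ gromovProduct o x y := by
  have := (HyperbolicSpace.four_point (S := S)).choose_spec.2 x y z o
  have := le_min h h'
  unfold hypConst
  linarith

/-- The sequence `x` represents the point `p` of `S ∪ ∂S`: it is constant if `p ∈ S`,
and it converges to `p` if `p ∈ ∂S`. -/
def Represents (x : ℕ → S) : Bordification S → Prop
  | .inner s => ∀ i, x i = s
  | .ideal a => ConvergesTo x a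

theorem exists_represents (p : Bordification S) : ∃ x : ℕ → S, Represents x p := by
  cases p with
  | inner s => exact ⟨fun _ => s, fun _ => rfl⟩
  | ideal a =>
    induction a using Quotient.inductionOn with
    | h x => exact ⟨x.1, x.2, rfl⟩

theorem ConvergesTo.productDiverges {x y : ℕ → S} {a : Boundary S} (hx : ConvergesTo x a)
    (hy : ConvergesTo y a) : ProductDiverges x y := by
  obtain ⟨hx, rfl⟩ := hx
  obtain ⟨hy, h⟩ := hy
  exact ProductDiverges.symm (Quotient.exact h)

/-- Two representatives of a point have almost the same products with other points. -/
theorem Represents.eventually_le {x x' : ℕ → S} {p : Bordification S} (hx : Represents x p)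
    (hx' : Represents x' p) (o : S) (r : ℝ) : ∃ N, ∀ i ≥ N, ∀ j ≥ N, ∀ z,
      r ≤ gromovProduct o (x i) z → r - hypConst S ≤ gromovProduct o (x' j) z := by
  cases p with
  | inner s =>
    refine ⟨0, fun i _ j _ z h => ?_⟩
    rw [hx' j]
    rw [hx i] at h
    linarith [hypConst_nonneg S]
  | ideal a =>
    obtain ⟨⟨m, n⟩, h⟩ := tendsto_atTop_atTop.1 (ConvergesTo.productDiverges hx' hx o) r
    exact ⟨max m n, fun i hi j hj z hz => le_gromovProduct
      (h (j, i) ⟨(le_max_left _ _).trans hj, (le_max_right _ _).trans hi⟩) hz⟩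

/-- The product of `p` and `q`, computed along any representatives, is eventually at least `r`. -/
def ProductGE (o : S) (r : ℝ) (p q : Bordification S) : Prop :=
  ∀ x y : ℕ → S, Represents x p → Represents y q →
    ∀ᶠ n : ℕ × ℕ in atTop, r ≤ gromovProduct o (x n.1) (y n.2)

/-- Each change of representative costs one hyperbolicity constant, so frequent largeness along one
pair of representatives gives eventual largeness along all pairs. -/
theorem ProductGE.of_frequently {o : S} {r : ℝ} {p q : Bordification S} {x y : ℕ → S}
    (hx : Represents x p) (hy : Represents y q)
    (h : ∃ᶠ n : ℕ × ℕ in atTop, r ≤ gromovProduct o (x n.1) (y n.2)) :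
    ProductGE o (r - 2 * hypConst S) p q := by
  intro x' y' hx' hy'
  obtain ⟨N, hN⟩ := hx.eventually_le hx' o r
  obtain ⟨N', hN'⟩ := hy.eventually_le hy' o (r - hypConst S)
  obtain ⟨n, hn, hr⟩ := frequently_atTop.1 h (N, N')
  refine eventually_atTop.2 ⟨(N, N'), fun m hm => ?_⟩
  have h1 := hN n.1 hn.1 m.1 hm.1 _ hr
  rw [gromovProduct_comm] at h1
  have h2 := hN' n.2 hn.2 m.2 hm.2 _ h1
  rw [gromovProduct_comm] at h2
  linarith

theorem ProductGE.eventually_lt_of_not {o : S} {r : ℝ} {p q : Bordification S}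
    (h : ¬ ProductGE o r p q) {x y : ℕ → S} (hx : Represents x p) (hy : Represents y q) :
    ∀ᶠ n : ℕ × ℕ in atTop, gromovProduct o (x n.1) (y n.2) < r + 2 * hypConst S := by
  by_contra hc
  refine h ?_
  have := ProductGE.of_frequently (o := o) (r := r + 2 * hypConst S) hx hy
    ((not_eventually.1 hc).mono fun n hn => not_lt.1 hn)
  simpa using this

theorem ProductGE.mono {o : S} {r r' : ℝ} {p q : Bordification S} (h : ProductGE o r p q)
    (hr : r' ≤ r) : ProductGE o r' p q :=
  fun x y hx hy => (h x y hx hy).mono fun _ hn => hr.trans hn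

theorem ProductGE.symm {o : S} {r : ℝ} {p q : Bordification S} (h : ProductGE o r p q) :
    ProductGE o r q p := by
  intro x y hx hy
  have hs : Tendsto (Prod.swap : ℕ × ℕ → ℕ × ℕ) atTop atTop := by
    rw [← prod_atTop_atTop_eq]
    exact tendsto_prod_swap
  refine (hs.eventually (h y x hy hx)).mono fun n hn => ?_
  rw [gromovProduct_comm]
  exact hn

theorem ProductGE.trans {o : S} {r : ℝ} {p q t : Bordification S} (h : ProductGE o r p q)
    (h' : ProductGE o r q t) : ProductGE o (r - hypConst S) p t := by
  intro x z hx hz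
  obtain ⟨y, hy⟩ := exists_represents q
  obtain ⟨⟨a, b⟩, hab⟩ := eventually_atTop.1 (h x y hx hy)
  obtain ⟨⟨c, d⟩, hcd⟩ := eventually_atTop.1 (h' y z hy hz)
  refine eventually_atTop.2 ⟨(a, d), fun n hn => ?_⟩
  exact le_gromovProduct (hab (n.1, max b c) ⟨hn.1, le_max_left _ _⟩)
    (hcd (max b c, n.2) ⟨le_max_right _ _, hn.2⟩)

theorem ProductGE.base_change {o : S} {r : ℝ} {p q : Bordification S} (h : ProductGE o r p q)
    (o' : S) : ProductGE o' (r - dist o o') p q :=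
  fun x y hx hy => (h x y hx hy).mono fun n hn => by
    linarith [gromovProduct_base_change o o' (x n.1) (y n.2)]

theorem ProductGE.point_change {o s : S} {r : ℝ} {p : Bordification S}
    (h : ProductGE o r p (.inner s)) (s' : S) : ProductGE o (r - dist s s') p (.inner s') := by
  intro x y hx hy
  refine (h x (fun _ => s) hx fun _ => rfl).mono fun n hn => ?_
  rw [hy n.2]
  linarith [gromovProduct_point_change o (x n.1) s s']

/-- This rests on the identity `⟨p | o⟩_q + ⟨p | q⟩_o = d(o, q)`: a small product seen from `q`
means a large one seen from `o`. -/
theorem ProductGE.of_not_reverse {o q : S} {r : ℝ} {p : Bordification S}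
    (h : ¬ ProductGE q r p (.inner o)) :
    ProductGE o (dist o q - r - 2 * hypConst S) p (.inner q) := by
  intro x y hx hy
  refine (ProductGE.eventually_lt_of_not h hx (y := fun _ => o) fun _ => rfl).mono fun n hn => ?_
  rw [hy n.2]
  unfold gromovProduct at hn ⊢
  linarith [dist_comm o q]

theorem ProductGE.le_dist {o q : S} {r : ℝ} {p : Bordification S}
    (h : ProductGE o r p (.inner q)) : r ≤ dist o q := by
  obtain ⟨x, hx⟩ := exists_represents p
  obtain ⟨n, hn⟩ := (h x (fun _ => q) hx fun _ => rfl).exists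
  unfold gromovProduct at hn
  linarith [dist_triangle (x n.1) q o, dist_comm o q]

theorem productGE_self (o : S) (r : ℝ) (a : Boundary S) : ProductGE o r (.ideal a) (.ideal a) :=
  fun _ _ hx hy => (ConvergesTo.productDiverges hx hy o).eventually_ge_atTop r

theorem exists_not_productGE {a b : Boundary S} (hab : a ≠ b) (o : S) :
    ∃ r, 0 ≤ r ∧ ¬ ProductGE o r (.ideal a) (.ideal b) := by
  by_contra! h
  refine hab ?_
  obtain ⟨x, hx⟩ := exists_represents (Bordification.ideal a)
  obtain ⟨y, hy⟩ := exists_represents (Bordification.ideal b)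
  obtain ⟨hx', rfl⟩ := id hx
  obtain ⟨hy', rfl⟩ := id hy
  refine Quotient.sound fun o' => tendsto_atTop.2 fun r => ?_
  have := (h (max 0 (r + dist o o')) (le_max_left _ _)).base_change o'
  exact (this.mono (by linarith [le_max_right 0 (r + dist o o')])) x y hx hy

theorem ProductGE.of_lt {o : S} {r : ℝ} {a : Boundary S} {p : Bordification S}
    (h : (r : EReal) < boundaryProduct o a p) : ProductGE o r (.ideal a) p := by
  intro x y hx hy
  cases p with
  | inner s =>
    have h1 : (r : EReal) < liminf (fun i : ℕ => ((gromovProduct o (x i) s : ℝ) : EReal)) atTop :=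
      h.trans_le (iInf₂_le x hx)
    have h2 := (tendsto_fst (f := (atTop : Filter ℕ)) (g := (atTop : Filter ℕ))).eventually
      (eventually_lt_of_lt_liminf h1)
    rw [prod_atTop_atTop_eq] at h2
    refine h2.mono fun n hn => ?_
    rw [hy n.2]
    exact (EReal.coe_lt_coe_iff.1 hn).le
  | ideal b =>
    have h1 : (r : EReal) < liminf
        (fun n : ℕ × ℕ => ((gromovProduct o (x n.1) (y n.2) : ℝ) : EReal)) atTop :=
      h.trans_le ((iInf₂_le x hx).trans (iInf₂_le y hy))
    exact (eventually_lt_of_lt_liminf h1).mono fun n hn => (EReal.coe_lt_coe_iff.1 hn).le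

theorem ProductGE.le_boundaryProduct {o : S} {r : ℝ} {a : Boundary S} {p : Bordification S}
    (h : ProductGE o r (.ideal a) p) : (r : EReal) ≤ boundaryProduct o a p := by
  cases p with
  | inner s =>
    refine le_iInf₂ fun x hx => ?_
    have h1 := h x (fun _ => s) hx fun _ => rfl
    obtain ⟨⟨m, n⟩, hmn⟩ := eventually_atTop.1 h1
    exact le_liminf_of_le (h := eventually_atTop.2 ⟨m, fun i hi =>
      EReal.coe_le_coe_iff.2 (hmn (i, n) ⟨hi, le_rfl⟩)⟩)
  | ideal b =>
    refine le_iInf₂ fun x hx => le_iInf₂ fun y hy => ?_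
    exact le_liminf_of_le (h := (h x y hx hy).mono fun n hn => EReal.coe_le_coe_iff.2 hn)

theorem setOf_productGE_mem_nhds (o : S) (r : ℝ) (a : Boundary S) :
    {p | ProductGE o r (.ideal a) p} ∈ 𝓝 (Bordification.ideal a) := by
  have hδ := hypConst_nonneg S
  set N : Set (Bordification S) := {p | ProductGE o r (.ideal a) p} with hN
  -- The set `N` need not be open, so `V` collects the points having a basic neighbourhood inside
  -- `N`.
  let V : Set (Bordification S) := {p | match p with
    | .inner s => s ∈ interior {s : S | Bordification.inner s ∈ N}
    | .ideal b => ∃ t, ∀ p, ProductGE o t (.ideal b) p → p ∈ N}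
  refine mem_nhds_iff.2 ⟨V, ?_, ⟨?_, ?_⟩, ⟨r, fun p hp => hp⟩⟩
  · rintro (s | b) hp
    · have h : s ∈ {s : S | Bordification.inner s ∈ N} := interior_subset hp
      exact h
    · obtain ⟨t, ht⟩ := hp
      exact ht _ (productGE_self o t b)
  · exact isOpen_interior
  · rintro b ⟨t, ht⟩ o'
    -- The `1` pays for moving within a unit ball, `hypConst S` for one use of transitivity, and the
    -- distance for the change of base point.
    refine ⟨t + 1 + hypConst S + dist o' o, fun p hp => ?_⟩
    have hp' := ((ProductGE.of_lt hp).base_change o).mono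
      (by linarith : t + 1 + hypConst S ≤ t + 1 + hypConst S + dist o' o - dist o' o)
    cases p with
    | inner s =>
      refine mem_interior_iff_mem_nhds.2 (Filter.mem_of_superset (Metric.ball_mem_nhds s one_pos)
        fun s' hs' => ht _ ((hp'.point_change s').mono ?_))
      rw [Metric.mem_ball'] at hs'
      linarith
    | ideal c =>
      refine ⟨t + 1 + hypConst S, fun q hq => ht _ ((hp'.trans hq).mono ?_)⟩
      linarith

theorem nhds_ideal_hasBasis (o : S) (a : Boundary S) :
    (𝓝 (Bordification.ideal a)).HasBasis (fun _ : ℝ => True)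
      fun r => {p | ProductGE o r (.ideal a) p} := by
  refine ⟨fun U => ⟨fun hU => ?_, fun ⟨r, _, h⟩ =>
    Filter.mem_of_superset (setOf_productGE_mem_nhds o r a) h⟩⟩
  obtain ⟨V, hVU, hV, haV⟩ := mem_nhds_iff.1 hU
  obtain ⟨r, hr⟩ := hV.2 a haV o
  refine ⟨r + 1, trivial, fun p hp => hVU (hr ?_)⟩
  exact (EReal.coe_lt_coe_iff.2 (lt_add_one r)).trans_le (ProductGE.le_boundaryProduct hp)

theorem nhds_boundary_hasBasis (o : S) (a : Boundary S) :
    (𝓝 a).HasBasis (fun _ : ℝ => True)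
      fun r => {b | ProductGE o r (.ideal a) (.ideal b)} := by
  rw [nhds_induced]
  exact (nhds_ideal_hasBasis o a).comap Bordification.ideal

theorem Boundary.nonempty_space (a : Boundary S) : Nonempty S :=
  let ⟨x, _⟩ := exists_represents (Bordification.ideal a)
  ⟨x 0⟩

instance boundary_t2Space : T2Space (Boundary S) := by
  refine t2Space_iff_disjoint_nhds.2 fun a b hab => ?_
  obtain ⟨o⟩ := a.nonempty_space
  obtain ⟨r, -, hr⟩ := exists_not_productGE hab o
  refine ((nhds_boundary_hasBasis o a).disjoint_iff (nhds_boundary_hasBasis o b)).2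
    ⟨r + hypConst S, trivial, r + hypConst S, trivial, Set.disjoint_left.2 fun c hc hc' => ?_⟩
  exact hr ((ProductGE.trans hc (ProductGE.symm hc')).mono (by linarith))

end Products

/-! ### North-south dynamics and the action on the limit set. -/

section Dynamics

variable {G : Type u} [Group G] {S : Type v} [MetricSpace S] [HyperbolicSpace S] [MulAction G S]

theorem mem_limitSet_iff {c : Boundary S} :
    c ∈ limitSet G S ↔ ∃ s : S, ∀ r : ℝ, ∃ k : G, ProductGE s r (.ideal c) (.inner (k • s)) := by
  refine exists_congr fun s => ?_
  rw [mem_closure_iff_nhds_basis (nhds_ideal_hasBasis s c)]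
  refine ⟨fun h r => ?_, fun h r _ => ?_⟩
  · obtain ⟨_, ⟨_, ⟨k, rfl⟩, rfl⟩, hk⟩ := h r trivial
    exact ⟨k, hk⟩
  · obtain ⟨k, hk⟩ := h r
    exact ⟨_, ⟨_, ⟨k, rfl⟩, rfl⟩, hk⟩

variable [IsIsometricSMul G S]

theorem ConvergesTo.smul (g : G) {x : ℕ → S} {a : Boundary S} (h : ConvergesTo x a) :
    ConvergesTo (fun i => g • x i) (g • a) := by
  obtain ⟨hx, rfl⟩ := h
  exact ⟨hx.smul g, rfl⟩

instance bordificationAction : MulAction G (Bordification S) where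
  smul g p := match p with
    | .inner s => .inner (g • s)
    | .ideal a => .ideal (g • a)
  one_smul p := by
    cases p with
    | inner s => exact congrArg Bordification.inner (one_smul G s)
    | ideal a => exact congrArg Bordification.ideal (one_smul G a)
  mul_smul g h p := by
    cases p with
    | inner s => exact congrArg Bordification.inner (mul_smul g h s)
    | ideal a => exact congrArg Bordification.ideal (mul_smul g h a)

theorem smul_inner (g : G) (s : S) :
    g • Bordification.inner s = Bordification.inner (g • s) := rfl

theorem smul_ideal (g : G) (a : Boundary S) :
    g • Bordification.ideal a = Bordification.ideal (g • a) := rfl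

theorem Represents.smul (g : G) {x : ℕ → S} {p : Bordification S} (h : Represents x p) :
    Represents (fun i => g • x i) (g • p) := by
  cases p with
  | inner s => exact fun i => congrArg (g • ·) (h i)
  | ideal a => exact ConvergesTo.smul g h

theorem ProductGE.smul (g : G) {o : S} {r : ℝ} {p q : Bordification S} (h : ProductGE o r p q) :
    ProductGE (g • o) r (g • p) (g • q) := by
  intro x y hx hy
  have hx' := hx.smul g⁻¹
  have hy' := hy.smul g⁻¹
  rw [inv_smul_smul] at hx' hy'
  refine (h _ _ hx' hy').mono fun n hn => ?_
  rwa [gromovProduct_smul, inv_inv] at hn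

theorem productGE_smul_iff (g : G) {o : S} {r : ℝ} {p q : Bordification S} :
    ProductGE (g • o) r (g • p) (g • q) ↔ ProductGE o r p q :=
  ⟨fun h => by simpa using h.smul g⁻¹, ProductGE.smul g⟩

instance boundary_continuousConstSMul : ContinuousConstSMul G (Boundary S) := by
  refine ⟨fun g => continuous_iff_continuousAt.2 fun a => ?_⟩
  obtain ⟨o⟩ := a.nonempty_space
  refine ((nhds_boundary_hasBasis o a).tendsto_iff (nhds_boundary_hasBasis (g • o) (g • a))).2
    fun r _ => ⟨r, trivial, fun b hb => ?_⟩
  exact ProductGE.smul g hb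

theorem smul_mem_limitSet (g : G) {c : Boundary S} (hc : c ∈ limitSet G S) :
    g • c ∈ limitSet G S := by
  rw [mem_limitSet_iff] at hc ⊢
  obtain ⟨s, hs⟩ := hc
  refine ⟨s, fun r => ?_⟩
  obtain ⟨k, hk⟩ := hs (r + dist (g • s) s)
  refine ⟨g * k, ?_⟩
  have := ((hk.smul g).base_change s).mono (by linarith : r ≤ _)
  rwa [smul_inner, smul_smul] at this

/-- If `g` has unbounded orbits and fixes two boundary points `a` and `b`, then its powers move
base points arbitrarily close to `a`, while the inverse powers move them close to `b`. -/
theorem exists_zpow_productGE {g : G} (o : S)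
    (hg : ¬ Bornology.IsBounded (Set.range fun n : ℤ => g ^ n • o)) {a b : Boundary S}
    (hab : a ≠ b) (ha : g • a = a) (hb : g • b = b) (r : ℝ) :
    ∃ k ∈ Subgroup.zpowers g, ProductGE o r (.ideal a) (.inner (k • o)) ∧
      ProductGE (k • o) r (.ideal b) (.inner o) := by
  have hδ := hypConst_nonneg S
  obtain ⟨E, hE, hE'⟩ := exists_not_productGE hab o
  have hfix {c : Boundary S} (hc : g • c = c) {k : G} (hk : k ∈ Subgroup.zpowers g) :
      k • Bordification.ideal c = Bordification.ideal c := by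
    have : k ∈ MulAction.stabilizer G c :=
      (Subgroup.zpowers_le (H := MulAction.stabilizer G c)).2 hc hk
    rw [smul_ideal, MulAction.mem_stabilizer_iff.1 this]
  have hEk {k : G} (hk : k ∈ Subgroup.zpowers g) :
      ¬ ProductGE (k • o) E (.ideal a) (.ideal b) := fun h => hE' <| by
    rw [← hfix ha hk, ← hfix hb hk] at h
    exact (productGE_smul_iff k).1 h
  -- Powers of `g` fix `a` and `b`, so these poles are as well separated from `k • o` as from `o`;
  -- hence `o` cannot lie in the direction of both.
  have hone {k : G} (hk : k ∈ Subgroup.zpowers g) {t : ℝ} (ht : E + hypConst S ≤ t)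
      (h : ProductGE (k • o) t (.ideal b) (.inner o)) :
      ¬ ProductGE (k • o) (E + hypConst S) (.ideal a) (.inner o) := fun h' =>
    hEk hk ((h'.trans (h.mono ht).symm).mono (by linarith))
  have hone' {k : G} (hk : k ∈ Subgroup.zpowers g) {t : ℝ} (ht : E + hypConst S ≤ t)
      (h : ProductGE (k • o) t (.ideal a) (.inner o)) :
      ¬ ProductGE (k • o) (E + hypConst S) (.ideal b) (.inner o) := fun h' =>
    hEk hk (((h.mono ht).trans h'.symm).mono (by linarith))
  set R := max r (E + hypConst S) with hR
  -- With this displacement, a pole not in the direction of `o` from `k • o` has product at least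
  -- `R` with `k • o` from `o`. Applying `k⁻¹` and repeating the argument shows that `k • o` and
  -- `k⁻¹ • o` approach different poles.
  have hfar : ∃ k ∈ Subgroup.zpowers g, R + E + 3 * hypConst S ≤ dist o (k • o) := by
    by_contra! h
    refine hg ((Metric.isBounded_closedBall (x := o) (r := R + E + 3 * hypConst S)).subset ?_)
    rintro _ ⟨n, rfl⟩
    rw [Metric.mem_closedBall']
    exact (h _ ⟨n, rfl⟩).le
  obtain ⟨k, hk, hd⟩ := hfar
  have hrev {c : Boundary S} {k : G} (hd : R + E + 3 * hypConst S ≤ dist o (k • o))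
      (h : ¬ ProductGE (k • o) (E + hypConst S) (.ideal c) (.inner o)) :
      ProductGE o R (.ideal c) (.inner (k • o)) :=
    (ProductGE.of_not_reverse h).mono (by linarith)
  have hflip {c : Boundary S} (hc : g • c = c) {k : G} (hk : k ∈ Subgroup.zpowers g)
      (h : ProductGE o R (.ideal c) (.inner (k • o))) :
      ProductGE (k⁻¹ • o) R (.ideal c) (.inner o) := by
    have := h.smul k⁻¹
    rwa [hfix hc (inv_mem hk), smul_inner, inv_smul_smul] at this
  have hdinv : dist o (k⁻¹ • o) = dist o (k • o) := by
    rw [← dist_smul k, smul_inv_smul, dist_comm]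
  by_cases h : ProductGE (k • o) (E + hypConst S) (.ideal a) (.inner o)
  · have h1 := hrev hd (hone' hk le_rfl h)
    have h2 := hflip hb hk h1
    have h3 := hrev (hdinv ▸ hd) (hone (inv_mem hk) (le_max_right _ _) h2)
    exact ⟨k⁻¹, inv_mem hk, h3.mono (le_max_left _ _), h2.mono (le_max_left _ _)⟩
  · have h1 := hrev hd h
    have h2 := hflip ha hk h1
    have h3 := hrev (hdinv ▸ hd) (hone' (inv_mem hk) (le_max_right _ _) h2)
    have h4 := hflip hb (inv_mem hk) h3
    rw [inv_inv] at h4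
    exact ⟨k, hk, h1.mono (le_max_left _ _), h4.mono (le_max_left _ _)⟩

/-- North-south dynamics. -/
theorem exists_zpow_maps_complement {g : G} (o : S)
    (hg : ¬ Bornology.IsBounded (Set.range fun n : ℤ => g ^ n • o)) {a b : Boundary S}
    (hab : a ≠ b) (ha : g • a = a) (hb : g • b = b) (r t : ℝ) :
    ∃ k ∈ Subgroup.zpowers g, ∀ p : Bordification S, ¬ ProductGE o r (.ideal b) p →
      ProductGE o t (.ideal a) (k • p) := by
  have hδ := hypConst_nonneg S
  obtain ⟨k, hk, hka, hkb⟩ := exists_zpow_productGE o hg hab ha hb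
    (|r| + |t| + 4 * hypConst S)
  have hr := le_abs_self r
  have ht := le_abs_self t
  have hr' := abs_nonneg r
  have ht' := abs_nonneg t
  have hkfix : k • b = b :=
    (Subgroup.zpowers_le (H := MulAction.stabilizer G b)).2 hb hk
  refine ⟨k, hk, fun p hp => ?_⟩
  -- Seen from `k • o`, the point `o` is near `b` and `k • p` is not, so `k • p` is far from the
  -- direction of `o`. Reversing the base point puts `k • p` near `k • o` seen from `o`, hence near
  -- `a`.
  rw [← productGE_smul_iff k, smul_ideal, hkfix] at hp
  have h1 : ¬ ProductGE (k • o) (r + hypConst S) (k • p) (.inner o) := fun h => hp <|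
    ((hkb.mono (by linarith)).trans h.symm).mono (by linarith)
  have h2 : ProductGE o (t + hypConst S) (k • p) (.inner (k • o)) :=
    (ProductGE.of_not_reverse h1).mono (by linarith [hka.le_dist])
  exact (((hka.mono (by linarith)).trans h2.symm).mono (by linarith))

/-- The limit set is contained in the closure of any orbit of pairs of distinct points. -/
theorem exists_smul_mem_of_ne {a b c : Boundary S} (hab : a ≠ b) (hc : c ∈ limitSet G S)
    {U : Set (Boundary S)} (hU : U ∈ 𝓝 c) : ∃ k : G, k • a ∈ U ∨ k • b ∈ U := by
  have hδ := hypConst_nonneg S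
  obtain ⟨s, hs⟩ := mem_limitSet_iff.1 hc
  obtain ⟨r, -, hr⟩ := (nhds_boundary_hasBasis s c).mem_iff.1 hU
  obtain ⟨E, -, hE⟩ := exists_not_productGE hab s
  obtain ⟨k, hk⟩ := hs (|r| + |E| + 4 * hypConst S)
  have hr0 := le_abs_self r
  have hE0 := le_abs_self E
  have hr1 := abs_nonneg r
  have hE1 := abs_nonneg E
  rw [← productGE_smul_iff k] at hE
  have key {d : Boundary S}
      (hd : ¬ ProductGE (k • s) (E + hypConst S) (k • Bordification.ideal d) (.inner s)) :
      k • d ∈ U := by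
    have h1 : ProductGE s (r + hypConst S) (k • Bordification.ideal d) (.inner (k • s)) :=
      (ProductGE.of_not_reverse hd).mono (by linarith [hk.le_dist])
    exact hr (((hk.mono (by linarith)).trans h1.symm).mono (by linarith))
  refine ⟨k, ?_⟩
  -- From `k • s`, at most one of `k • a`, `k • b` lies in the direction of `s`; the other has a
  -- large product with `k • s` from `s`, and `k • s` is close to `c`.
  by_cases h : ProductGE (k • s) (E + hypConst S) (k • Bordification.ideal a) (.inner s)
  · exact Or.inr (key fun h' => hE ((h.trans h'.symm).mono (by linarith)))
  · exact Or.inl (key h)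

/-- A form of loxodromic isometry that suffices for north-south dynamics: the powers of `g` have
unbounded orbits, and `g` fixes the distinct boundary points `a` and `b`. -/
structure HasPoles (g : G) (a b : Boundary S) : Prop where
  unbounded : ∀ s : S, ¬ Bornology.IsBounded (Set.range fun n : ℤ => g ^ n • s)
  ne : a ≠ b
  left : g • a = a
  right : g • b = b

theorem HasPoles.symm {g : G} {a b : Boundary S} (h : HasPoles g a b) : HasPoles g b a :=
  ⟨h.unbounded, h.ne.symm, h.right, h.left⟩

theorem IsLoxodromic.exists_hasPoles {g : G} (hg : IsLoxodromic S g) :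
    ∃ a b : Boundary S, HasPoles g a b ∧ MulAction.fixedBy (Boundary S) g = {a, b} := by
  obtain ⟨a, b, hab, h⟩ := Set.encard_eq_two.1 hg.2
  have ha : a ∈ MulAction.fixedBy (Boundary S) g := h ▸ Or.inl rfl
  have hb : b ∈ MulAction.fixedBy (Boundary S) g := h ▸ Or.inr rfl
  exact ⟨a, b, ⟨hg.1, hab, ha, hb⟩, h⟩

theorem HasPoles.mem_limitSet {g : G} {a b : Boundary S} (h : HasPoles g a b) :
    a ∈ limitSet G S := by
  obtain ⟨o⟩ := a.nonempty_space
  refine mem_limitSet_iff.2 ⟨o, fun r => ?_⟩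
  obtain ⟨k, -, hk, -⟩ := exists_zpow_productGE o (h.unbounded o) h.ne h.left h.right r
  exact ⟨k, hk⟩

/-- The powers of `g` push the complement of a neighbourhood `V` of one pole into any
neighbourhood `U` of the other one. -/
theorem HasPoles.exists_zpow_maps {g : G} {a b : Boundary S} (h : HasPoles g a b)
    {U V : Set (Boundary S)} (hU : U ∈ 𝓝 a) (hV : V ∈ 𝓝 b) :
    ∃ k ∈ Subgroup.zpowers g, ∀ c ∉ V, k • c ∈ U := by
  obtain ⟨o⟩ := a.nonempty_space
  obtain ⟨t, -, ht⟩ := (nhds_boundary_hasBasis o a).mem_iff.1 hU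
  obtain ⟨r, -, hr⟩ := (nhds_boundary_hasBasis o b).mem_iff.1 hV
  obtain ⟨k, hk, hk'⟩ :=
    exists_zpow_maps_complement o (h.unbounded o) h.ne h.left h.right r t
  exact ⟨k, hk, fun c hc => ht (hk' (.ideal c) fun hc' => hc (hr hc'))⟩

theorem HasPoles.exists_zpow_smul_mem {g : G} {a b c : Boundary S} (h : HasPoles g a b)
    (hc : c ≠ b) {U : Set (Boundary S)} (hU : U ∈ 𝓝 a) : ∃ k ∈ Subgroup.zpowers g, k • c ∈ U := by
  obtain ⟨k, hk, hk'⟩ := h.exists_zpow_maps hU (isOpen_compl_singleton.mem_nhds hc.symm)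
  exact ⟨k, hk, hk' c (by simp)⟩

theorem smul_preimage_mem_nhds (k : G) {a : Boundary S} {U : Set (Boundary S)}
    (hU : U ∈ 𝓝 (k • a)) : (fun x => k • x) ⁻¹' U ∈ 𝓝 a :=
  (continuous_const_smul k).continuousAt.preimage_mem_nhds hU

/-- If `G` does not fix the pole `a` of `g`, then the orbit of `a` is dense in the limit set. -/
theorem HasPoles.exists_smul_mem {g h : G} {a b c : Boundary S} (hg : HasPoles g a b)
    (ha : h • a ≠ a) (hc : c ∈ limitSet G S) {U : Set (Boundary S)} (hU : IsOpen U)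
    (hcU : c ∈ U) : ∃ k : G, k • a ∈ U := by
  obtain ⟨k, hk | hk⟩ := exists_smul_mem_of_ne hg.ne hc (hU.mem_nhds hcU)
  · exact ⟨k, hk⟩
  -- Here only `k • b` is known to lie in `U`; as `h • a ≠ a`, a power of `g` pushes `h • a` close
  -- enough to `b` for `k` to send it into `U`.
  · obtain ⟨m, -, hm⟩ :=
      hg.symm.exists_zpow_smul_mem ha (smul_preimage_mem_nhds k (hU.mem_nhds hk))
    exact ⟨k * (m * h), by simpa only [mul_smul, Set.mem_preimage] using hm⟩

instance limitSetAction : MulAction G (limitSet G S) where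
  smul g c := ⟨g • c.1, smul_mem_limitSet g c.2⟩
  one_smul c := Subtype.ext (one_smul G c.1)
  mul_smul g h c := Subtype.ext (mul_smul g h c.1)

theorem coe_smul_limitSet (g : G) (c : limitSet G S) :
    ((g • c : limitSet G S) : Boundary S) = g • (c : Boundary S) := rfl

instance limitSet_continuousConstSMul : ContinuousConstSMul G (limitSet G S) :=
  ⟨fun g => ((continuous_const_smul g).comp continuous_subtype_val).subtype_mk _⟩

variable (G S) in
theorem IsGeneralType.compresses (h : IsGeneralType G S) :
    Compresses (limitSet G S) (⊤ : Subgroup G) := by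
  obtain ⟨-, g, h, hg, hh, hdisj⟩ := h
  obtain ⟨a, b, hab, -⟩ := hg.exists_hasPoles
  have hmove {d : Boundary S} (hd : g • d = d) : h • d ≠ d := fun hd' =>
    Set.disjoint_left.1 hdisj hd hd'
  rintro C hC hC' U hU ⟨u, hu⟩
  obtain ⟨c, hc⟩ := (Set.ne_univ_iff_exists_notMem C).1 hC'
  obtain ⟨V, hV, rfl⟩ := isOpen_induced_iff.1 hU
  obtain ⟨W, hW, hWC⟩ := isOpen_induced_iff.1 hC.isOpen_compl
  have hcW : (c : Boundary S) ∈ W := by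
    have : c ∈ Subtype.val ⁻¹' W := hWC ▸ hc
    exact this
  -- Choose translates `k • a` in `U` and `l • b` off `C`. Then `l⁻¹` moves `C` away from `b`, a
  -- power of `g` pushes it towards `a`, and `k` takes it into `U`.
  obtain ⟨k, hk⟩ := hab.exists_smul_mem (hmove hab.left) u.2 hV hu
  obtain ⟨l, hl⟩ := hab.symm.exists_smul_mem (hmove hab.right) c.2 hW hcW
  obtain ⟨m, -, hm⟩ := hab.exists_zpow_maps (smul_preimage_mem_nhds k (hV.mem_nhds hk))
    (smul_preimage_mem_nhds l (hW.mem_nhds hl))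
  refine ⟨k * (m * l⁻¹), trivial, fun x hx => ?_⟩
  have hxW : (x : Boundary S) ∉ W := fun h => by
    have : x ∈ Subtype.val ⁻¹' W := h
    rw [hWC] at this
    exact this hx
  have := hm (l⁻¹ • (x : Boundary S)) (by simpa using hxW)
  simpa only [Set.mem_preimage, coe_smul_limitSet, mul_smul] using this

variable (G S) in
-- If the limit set were finite it would be discrete, so some power of `g` would send `c`, a pole of
-- `h`, exactly onto the pole `a`; that power also fixes `a`, so `c = a`, against disjointness.
theorem IsGeneralType.infinite_limitSet (h : IsGeneralType G S) : Infinite (limitSet G S) := by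
  obtain ⟨-, g, h, hg, hh, hdisj⟩ := h
  obtain ⟨a, b, hab, -⟩ := hg.exists_hasPoles
  obtain ⟨c, d, hcd, -⟩ := hh.exists_hasPoles
  have hne {x : Boundary S} (hx : g • x = x) : c ≠ x := fun hcx =>
    Set.disjoint_left.1 hdisj hx (hcx ▸ hcd.left)
  by_contra hfin
  rw [not_infinite_iff_finite] at hfin
  obtain ⟨V, hV, hVa⟩ := isOpen_induced_iff.1
    (isOpen_discrete ({⟨a, hab.mem_limitSet⟩} : Set (limitSet G S)))
  have haV : a ∈ V := by
    have : (⟨a, hab.mem_limitSet⟩ : limitSet G S) ∈ Subtype.val ⁻¹' V := hVa ▸ rfl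
    exact this
  obtain ⟨k, hk, hkV⟩ := hab.exists_zpow_smul_mem (hne hab.right) (hV.mem_nhds haV)
  have hmem : (⟨k • c, smul_mem_limitSet k hcd.mem_limitSet⟩ : limitSet G S) ∈
      Subtype.val ⁻¹' V := hkV
  rw [hVa] at hmem
  have hka : k • a = a := (Subgroup.zpowers_le (H := MulAction.stabilizer G a)).2 hab.left hk
  have hkc : k • c = k • a := (congrArg Subtype.val hmem).trans hka.symm
  exact hne hab.left (smul_left_cancel k hkc)

end Dynamics

end WeakHyp

theorem mainTheorem5 (G : Type u) [Group G]
    (hG : WeakHyp.IsFaithfulWeaklyHyperbolic.{u, v} G)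
    (hlim : ¬ WeakHyp.IsLimFree.{u, v} G) :
    WeakHyp.IsMonolithic G ∧ Infinite (WeakHyp.monolith G) ∧
      IsSimpleGroup (WeakHyp.monolith G) := by
  obtain ⟨S, _, _, _, _, hgen, hfaith⟩ := hG
  have hntf : ¬ WeakHyp.TopologicallyFreeOnLimitSet G S := fun h =>
    hlim ⟨S, _, inferInstance, _, inferInstance, hgen, h⟩
  unfold WeakHyp.TopologicallyFreeOnLimitSet at hntf
  push Not at hntf
  obtain ⟨g, hg, hfix⟩ := hntf
  have := hgen.infinite_limitSet
  have : FaithfulSMul G (WeakHyp.limitSet G S) := by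
    refine ⟨fun {g h} hgh => ?_⟩
    refine eq_of_inv_mul_eq_one (hfaith _ fun a ha => ?_)
    have := congrArg Subtype.val (hgh ⟨a, ha⟩)
    rw [WeakHyp.coe_smul_limitSet, WeakHyp.coe_smul_limitSet] at this
    rw [mul_smul, inv_smul_eq_iff]
    exact this.symm
  refine WeakHyp.monolith_of_compresses hgen.compresses hg (X := WeakHyp.limitSet G S) ?_
  convert hfix using 4
  exact Subtype.ext_iff
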